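/- Let $T=(t_s)_{s\in\mathbb{Z}}$ be i.i.d. random variables, uniformly distributed on $[0,1]$, and let $\mathbb{P}$ be their law, the product measure on $[0,1]^{\mathbb{Z}}$. In random sequential adsorption with nearest-neighbor exclusion on $\mathbb{Z}$, all sites start vacant and a particle is deposited at site $s$ at time $t_s$ if the sites $s-1$ and $s+1$ are both vacant at that time. That is, the states $\omega_s(t)\in\{0,1\}$ ($1$ for occupied, $0$ for vacant; $s\in\mathbb{Z}$, $t\in[0,1]$) satisfy $$\omega_s(t)=\mathbf 1\{t_s\le t\}\,\mathbf 1\{\omega_{s-1}(t_s)=0\}\,\mathbf 1\{\omega_{s+1}(t_s)=0\}\qquad (s\in\mathbb{Z},\ t\in[0,1]).$$ For $\mathbb{P}$-almost every $T$ this system has exactly one solution $(\omega_s(t))_{s\in\mathbb{Z},\,t\in[0,1]}$, and each $\omega_s(t)$ is a random variable. The pair correlation $C_s(t)=\mathbb{E}[\omega_0(t)\omega_s(t)]-\mathbb{E}[\omega_0(t)]\,\mathbb{E}[\omega_s(t)]$ satisfies, for all $t\in[0,1]$ and all $s\in\mathbb{Z}$, $$C_s(t)=-\tfrac12\,e^{-2t}\sum_{n=0}^{\infty}\frac{(-2t)^{2n+|s|+1}}{(2n+|s|+1)!},$$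 where the series converges absolutely. -/

import Mathlib

namespace RSA

open MeasureTheory

/-- The law of an i.i.d. family of arrival times `(t_s)_{s ∈ ℤ}`, each uniform on `[0,1]`:
the product of the Lebesgue measures on `[0,1]`. -/
noncomputable def timesLaw : Measure (ℤ → unitInterval) :=
  Measure.infinitePi (fun _ : ℤ => (volume : Measure unitInterval))

/-- `η` is an evolution of random sequential adsorption with nearest-neighbour exclusion on `ℤ`
driven by the arrival times `T`; here `η s t` is the state of the site `s` at time `t`
(`1` if occupied, `0` if vacant). It is the product of the indicators of `T s ≤ t`, of
"`s - 1` is vacant at time `T s`" and of "`s + 1` is vacant at time `T s`". -/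
def IsEvolution (T : ℤ → unitInterval) (η : ℤ → unitInterval → ℝ) : Prop :=
  ∀ (s : ℤ) (t : unitInterval),
    η s t = (if T s ≤ t then 1 else 0) *
      (if η (s - 1) (T s) = 0 then 1 else 0) *
      (if η (s + 1) (T s) = 0 then 1 else 0)

open Classical in
/-- The state `ω_s(T, t)`: the value of the unique evolution driven by `T`
(and `0` for those `T` that do not determine a unique evolution). -/
noncomputable def state (s : ℤ) (t : unitInterval) (T : ℤ → unitInterval) : ℝ :=
  if h : ∃! η : ℤ → unitInterval → ℝ, IsEvolution T η then h.choose s t else 0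

/-- `Cov_t(i, j) = E[ω_i(t) ω_j(t)] - E[ω_i(t)] E[ω_j(t)]`. -/
noncomputable def covAt (t : unitInterval) (i j : ℤ) : ℝ :=
  (∫ T, state i t T * state j t T ∂timesLaw) -
    (∫ T, state i t T ∂timesLaw) * (∫ T, state j t T ∂timesLaw)

/-- The pair correlation `C_s(t) = Cov_t(0, s)`. -/
noncomputable def pairCorrelation (s : ℤ) (t : unitInterval) : ℝ := covAt t 0 s

end RSA

/-! A site `s` accepts its particle exactly when both neighbours are vacant at time `T s`. The right
neighbour can block `s` only if it arrives earlier; as `s` is then still empty, its fate depends on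
its own right neighbour alone. Iterating, the right neighbour is vacant at time `T s` iff the run of
decreasing arrival times going right from `s` has even length, and likewise on the left. Almost
surely all runs are finite, so the evolution exists, is unique and is a product of an arrival
indicator and two run parities (`IsEvolution.eq_altRun`, `Generic.existsUnique`).

Given `T s = u`, a run is even with probability `exp (-u)`; truncated at finite depth, this is a
partial sum `expNegSum` (`integral_mul_altRun`). Hence the density is `∫₀ᵗ exp (-2u) du`. For two
sites at distance `n + 1`, `altRun_add_mul` cuts the inward runs at the opposite site, so the weight
factors into the two outward runs and an isolated segment. Given the end times, the segment
contributes `segmentPair`, found by peeling off one site at a time (`integral_mul_segment`).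
Integrating over the earlier end time gives the pair probability `∫₀ᵗ exp (-2u) (1 - expNegSum s
(2u)) du` (`integral_state_mul`), a formula that at `s = 0` returns the density.

Sums over consecutive distances are elementary on both sides: the integrand becomes an exact
derivative, and the two parity series merge into a full exponential tail. Induction on the distance,
starting from the variance, then gives the identity (`pairProb_sub_sq`). -/

namespace RSA

open MeasureTheory Filter Topology


/-! ### Parity of descending runs -/

/-- `altRun n a = ∑_{k ≤ n} (-1)^k 1{a 0 > a 1 > ⋯ > a k}`, defined by recursion: whether the
initial descending run of `a`, truncated after `n` steps, has even length. -/
noncomputable def altRun : ℕ → (ℕ → unitInterval) → ℝ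
  | 0, _ => 1
  | n + 1, a => 1 - if a 1 < a 0 then altRun n (fun k => a (k + 1)) else 0

theorem altRun_zero (a : ℕ → unitInterval) : altRun 0 a = 1 := rfl

theorem altRun_succ (n : ℕ) (a : ℕ → unitInterval) :
    altRun (n + 1) a = 1 - if a 1 < a 0 then altRun n (fun k => a (k + 1)) else 0 := rfl

theorem altRun_eq_zero_or_one (n : ℕ) (a : ℕ → unitInterval) :
    altRun n a = 0 ∨ altRun n a = 1 := by
  induction n generalizing a with
  | zero => exact Or.inr rfl
  | succ n ih =>
    rw [altRun_succ]
    split_ifs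
    · rcases ih (fun k => a (k + 1)) with h | h <;> simp [h]
    · simp

theorem altRun_mul_self (n : ℕ) (a : ℕ → unitInterval) :
    altRun n a * altRun n a = altRun n a := by
  rcases altRun_eq_zero_or_one n a with h | h <;> simp [h]

theorem abs_altRun_le_one (n : ℕ) (a : ℕ → unitInterval) : |altRun n a| ≤ 1 := by
  rcases altRun_eq_zero_or_one n a with h | h <;> simp [h]

theorem altRun_eq_of_not_lt {k : ℕ} {a : ℕ → unitInterval} (h : ¬ a (k + 1) < a k) {n : ℕ}
    (hn : k ≤ n) : altRun n a = altRun k a := by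
  induction k generalizing a n with
  | zero =>
    cases n with
    | zero => rfl
    | succ n => rw [altRun_succ, if_neg h, sub_zero, altRun_zero]
  | succ k ih =>
    obtain ⟨n, rfl⟩ : ∃ m, n = m + 1 := ⟨n - 1, by omega⟩
    rw [altRun_succ, altRun_succ, ih (a := fun k => a (k + 1)) h (by omega : k ≤ n)]

/-- When the second factor is 1, a run that reaches index `s` continues from there by an even number
of steps, so cutting it at `s` keeps its parity. This decouples two sites: the inward run of one may
be stopped at the other. -/
theorem altRun_add_mul (s m : ℕ) (a : ℕ → unitInterval) :
    altRun (s + m) a * altRun m (fun k => a (k + s)) =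
      altRun s a * altRun m (fun k => a (k + s)) := by
  induction s generalizing a with
  | zero => simp [altRun_zero, altRun_mul_self]
  | succ s ih =>
    have h := ih (fun k => a (k + 1))
    rw [show s + 1 + m = (s + m) + 1 by ring, altRun_succ, altRun_succ]
    simp only [add_assoc, add_comm s 1] at h ⊢
    split_ifs
    · linear_combination -h
    · rfl

theorem altRun_sub_succ (n : ℕ) (a : ℕ → unitInterval) :
    altRun n a - altRun (n + 1) a = (-1) ^ n * if ∀ k ≤ n, a (k + 1) < a k then 1 else 0 := by
  induction n generalizing a with
  | zero => simp [altRun_succ, altRun_zero]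
  | succ n ih =>
    have h := ih (fun k => a (k + 1))
    rw [altRun_succ n, altRun_succ (n + 1)]
    have hiff : (∀ k ≤ n + 1, a (k + 1) < a k) ↔
        a 1 < a 0 ∧ ∀ k ≤ n, a (k + 1 + 1) < a (k + 1) := by
      constructor
      · exact fun h => ⟨h 0 (by omega), fun k hk => h (k + 1) (by omega)⟩
      · rintro ⟨h0, h1⟩ k hk
        cases k with
        | zero => exact h0
        | succ k => exact h1 k (by omega)
    simp only [hiff]
    by_cases h0 : a 1 < a 0
    · simp only [h0, if_true, true_and]
      linear_combination -h
    · simp [h0]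

/-! ### Existence, uniqueness and explicit form of the evolution -/

/-- The arrival times read from the site `s` in the direction `ε`. -/
def ray (ε s : ℤ) (T : ℤ → unitInterval) (k : ℕ) : unitInterval := T (s + ε * k)

theorem ray_zero (ε s : ℤ) (T : ℤ → unitInterval) : ray ε s T 0 = T s := by simp [ray]

theorem ray_one (ε s : ℤ) (T : ℤ → unitInterval) : ray ε s T 1 = T (s + ε) := by simp [ray]

theorem ray_shift (ε s : ℤ) (T : ℤ → unitInterval) :
    (fun k => ray ε s T (k + 1)) = ray ε (s + ε) T := by
  funext k
  simp only [ray]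
  congr 1
  push_cast
  ring

theorem altRun_ray_succ (n : ℕ) (ε s : ℤ) (T : ℤ → unitInterval) :
    altRun (n + 1) (ray ε s T) =
      1 - if T (s + ε) < T s then altRun n (ray ε (s + ε) T) else 0 := by
  rw [altRun_succ, ray_shift, ray_one, ray_zero]

/-- Neighbouring sites have distinct arrival times, and no ray of sites has decreasing ones. -/
def Generic (T : ℤ → unitInterval) : Prop :=
  (∀ s, T s ≠ T (s + 1)) ∧
    (∀ s, ∃ k, ¬ ray 1 s T (k + 1) < ray 1 s T k) ∧
    ∀ s, ∃ k, ¬ ray (-1) s T (k + 1) < ray (-1) s T k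

/-- A neighbour in the direction `ε` is vacant at the arrival time of `s` if and only if the
descending run of arrival times in this direction has even length. -/
theorem ite_evolution_eq_altRun {T : ℤ → unitInterval} {η : ℤ → unitInterval → ℝ} {ε : ℤ}
    (hη : ∀ s t, η s t = (if T s ≤ t then 1 else 0) * (if η (s - ε) (T s) = 0 then 1 else 0) *
      (if η (s + ε) (T s) = 0 then 1 else 0))
    (hT : ∀ s, T s ≠ T (s + ε)) (k : ℕ) (s : ℤ)
    (hk : ¬ ray ε s T (k + 1) < ray ε s T k) :
    (if η (s + ε) (T s) = 0 then (1 : ℝ) else 0) = altRun k (ray ε s T) := by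
  induction k generalizing s with
  | zero =>
    have h : ¬ T (s + ε) ≤ T s := by
      rw [ray_zero, ray_one] at hk
      exact fun h => hk (lt_of_le_of_ne h (hT s).symm)
    rw [hη (s + ε)]
    simp [h, altRun_zero]
  | succ k ih =>
    rw [altRun_ray_succ, hη (s + ε)]
    by_cases h : T (s + ε) < T s
    · have hk' : ¬ ray ε (s + ε) T (k + 1) < ray ε (s + ε) T k := by
        rw [← ray_shift]
        exact hk
      -- The site `s` arrives after `s + ε`, so it cannot block it; only the site beyond `s + ε`
      -- can.
      have h0 : η s (T (s + ε)) = 0 := by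
        rw [hη s]
        simp [not_le.2 h]
      rw [ih (s + ε) hk', if_pos h, add_sub_cancel_right]
      rcases altRun_eq_zero_or_one k (ray ε (s + ε) T) with h1 | h1 <;> simp [h1, h0, h.le]
    · have h' : ¬ T (s + ε) ≤ T s := fun h' => h (lt_of_le_of_ne h' (hT s).symm)
      simp [h, h']

theorem IsEvolution.eq_altRun {T : ℤ → unitInterval} {η : ℤ → unitInterval → ℝ}
    (hη : IsEvolution T η) (hT : ∀ s, T s ≠ T (s + 1)) (s : ℤ) (t : unitInterval) {k l : ℕ}
    (hk : ¬ ray (-1) s T (k + 1) < ray (-1) s T k) (hl : ¬ ray 1 s T (l + 1) < ray 1 s T l) :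
    η s t = (if T s ≤ t then 1 else 0) * altRun k (ray (-1) s T) * altRun l (ray 1 s T) := by
  rw [← ite_evolution_eq_altRun hη hT l s hl, ← ite_evolution_eq_altRun (η := η) ?_ ?_ k s hk,
    hη s t]
  · rfl
  · intro s t
    rw [hη s t, sub_neg_eq_add, ← sub_eq_add_neg]
    ring
  · intro s
    have h := hT (s + -1)
    rw [neg_add_cancel_right] at h
    exact h.symm

/-- The values in `{0, 1}` determined along all rays in the direction `ε`. -/
theorem exists_altRun_limit {T : ℤ → unitInterval} {ε : ℤ}
    (h : ∀ s, ∃ k, ¬ ray ε s T (k + 1) < ray ε s T k) :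
    ∃ A : ℤ → ℝ, (∀ s, A s = 0 ∨ A s = 1) ∧
      ∀ s, A s = 1 - if T (s + ε) < T s then A (s + ε) else 0 := by
  choose N hN using h
  refine ⟨fun s => altRun (N s) (ray ε s T), fun s => altRun_eq_zero_or_one _ _, fun s => ?_⟩
  have h1 := altRun_eq_of_not_lt (hN s) (n := max (N s) (N (s + ε)) + 1) (by omega)
  have h2 := altRun_eq_of_not_lt (hN (s + ε)) (n := max (N s) (N (s + ε))) (by omega)
  simp only
  rw [← h1, altRun_ray_succ, h2]

theorem Generic.existsUnique {T : ℤ → unitInterval} (hT : Generic T) :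
    ∃! η : ℤ → unitInterval → ℝ, IsEvolution T η := by
  obtain ⟨hne, hR, hL⟩ := hT
  obtain ⟨A, hA01, hA⟩ := exists_altRun_limit hR
  obtain ⟨B, hB01, hB⟩ := exists_altRun_limit hL
  refine ⟨fun s t => (if T s ≤ t then 1 else 0) * B s * A s, ?_, ?_⟩
  · intro s t
    -- If `s - 1` arrives before `s`, then `A (s - 1) = 1` and `B s = 1 - B (s - 1)`; otherwise `s -
    -- 1` is still empty and `B s = 1`.
    have hl : (if (if T (s - 1) ≤ T s then 1 else 0) * B (s - 1) * A (s - 1) = 0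
        then (1 : ℝ) else 0) = B s := by
      have h := hA (s - 1)
      have h' := hne (s - 1)
      rw [sub_add_cancel] at h h'
      rw [hB s, ← sub_eq_add_neg, h]
      rcases lt_or_gt_of_ne h' with h1 | h1
      · rcases hB01 (s - 1) with h2 | h2 <;> simp [h1, h1.le, not_lt.2 h1.le, h2]
      · simp [not_le.2 h1, not_lt.2 h1.le]
    have hr : (if (if T (s + 1) ≤ T s then 1 else 0) * B (s + 1) * A (s + 1) = 0
        then (1 : ℝ) else 0) = A s := by
      have h := hB (s + 1)
      rw [add_neg_cancel_right] at h
      rw [hA s, h]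
      rcases lt_or_gt_of_ne (hne s) with h1 | h1
      · simp [not_le.2 h1, not_lt.2 h1.le]
      · rcases hA01 (s + 1) with h2 | h2 <;> simp [h1, h1.le, not_lt.2 h1.le, h2]
    simp only
    rw [hl, hr]
  · intro η hη
    funext s t
    obtain ⟨k, hk⟩ := hL s
    obtain ⟨l, hl⟩ := hR s
    have hE : ∀ (s ε : ℤ) (C : ℤ → ℝ),
        (∀ s, C s = 1 - if T (s + ε) < T s then C (s + ε) else 0) →
        ∀ k, ¬ ray ε s T (k + 1) < ray ε s T k → altRun k (ray ε s T) = C s := by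
      intro s ε C hC k hk
      induction k generalizing s with
      | zero =>
        rw [ray_zero, ray_one] at hk
        rw [hC s, if_neg hk, altRun_zero, sub_zero]
      | succ k ih =>
        rw [altRun_ray_succ, hC s, ih (s + ε)]
        rw [← ray_shift]
        exact hk
    rw [hη.eq_altRun hne s t hk hl, hE s (-1) B hB k hk, hE s 1 A hA l hl]

/-- The state of the site `s` at time `t` in the system that ignores all sites below `s - m` and
above `s + n`. -/
noncomputable def truncState (m n : ℕ) (s : ℤ) (t : unitInterval) (T : ℤ → unitInterval) : ℝ :=
  (if T s ≤ t then 1 else 0) * altRun m (ray (-1) s T) * altRun n (ray 1 s T)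

theorem Generic.exists_state_eq {T : ℤ → unitInterval} (hT : Generic T) (s : ℤ) :
    ∃ k, ∀ m n, k ≤ m → k ≤ n → ∀ t, state s t T = truncState m n s t T := by
  obtain ⟨k, hk⟩ := hT.2.2 s
  obtain ⟨l, hl⟩ := hT.2.1 s
  refine ⟨max k l, fun m n hm hn t => ?_⟩
  have h := hT.existsUnique
  rw [state, dif_pos h, truncState, altRun_eq_of_not_lt hk (by omega : k ≤ m),
    altRun_eq_of_not_lt hl (by omega : l ≤ n)]
  exact IsEvolution.eq_altRun h.choose_spec.1 hT.1 s t hk hl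

theorem truncState_eq_zero_or_one (m n : ℕ) (s : ℤ) (t : unitInterval) (T : ℤ → unitInterval) :
    truncState m n s t T = 0 ∨ truncState m n s t T = 1 := by
  rw [truncState]
  rcases altRun_eq_zero_or_one m (ray (-1) s T) with h | h <;>
  rcases altRun_eq_zero_or_one n (ray 1 s T) with h' | h' <;>
  split_ifs <;> simp [h, h']


/-! ### Integrating out single arrival times -/

instance : IsProbabilityMeasure timesLaw := by
  unfold timesLaw
  infer_instance

theorem measurable_update_prod (s : ℤ) :
    Measurable fun q : (ℤ → unitInterval) × unitInterval => Function.update q.1 s q.2 := by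
  refine measurable_pi_lambda _ fun i => ?_
  by_cases h : i = s
  · subst h
    simpa using measurable_snd
  · simp only [Function.update_of_ne h]
    exact (measurable_pi_apply i).comp measurable_fst

/-- Resampling one arrival time preserves the law. -/
theorem measurePreserving_update (s : ℤ) :
    MeasurePreserving (fun q : (ℤ → unitInterval) × unitInterval => Function.update q.1 s q.2)
      (timesLaw.prod volume) timesLaw := by
  refine ⟨measurable_update_prod s, ?_⟩
  refine Measure.eq_infinitePi (fun _ => volume) fun F t ht => ?_
  have hm : ∀ G : Finset ℤ, timesLaw (Set.pi G t) = ∏ i ∈ G, volume (t i) := fun G =>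
    Measure.infinitePi_pi _ fun i _ => ht i
  rw [Measure.map_apply (measurable_update_prod s)
    (MeasurableSet.pi F.countable_toSet fun i _ => ht i)]
  by_cases hs : s ∈ F
  · have : (fun q : (ℤ → unitInterval) × unitInterval => Function.update q.1 s q.2) ⁻¹'
        Set.pi F t = Set.pi (F.erase s : Finset ℤ) t ×ˢ t s := by
      ext q
      simp only [Set.mem_preimage, Set.mem_pi, Set.mem_prod, Finset.coe_erase, Set.mem_sdiff,
        Finset.mem_coe, Set.mem_singleton_iff]
      constructor
      · intro h
        refine ⟨fun i hi => ?_, by simpa using h s hs⟩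
        simpa [Function.update_of_ne hi.2] using h i hi.1
      · rintro ⟨h1, h2⟩ i hi
        by_cases h : i = s
        · subst h
          simpa using h2
        · simpa [Function.update_of_ne h] using h1 i ⟨hi, h⟩
    rw [this, Measure.prod_prod, hm, Finset.prod_erase_mul _ _ hs]
  · have : (fun q : (ℤ → unitInterval) × unitInterval => Function.update q.1 s q.2) ⁻¹'
        Set.pi F t = Set.pi (F : Set ℤ) t ×ˢ Set.univ := by
      ext q
      simp only [Set.mem_preimage, Set.mem_pi, Set.mem_prod, Finset.mem_coe, Set.mem_univ,
        and_true]
      refine forall₂_congr fun i hi => ?_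
      rw [Function.update_of_ne (ne_of_mem_of_not_mem hi hs)]
    rw [this, Measure.prod_prod, hm, measure_univ, mul_one]

/-- Bounded random variables. -/
def IsBddMeasurable (F : (ℤ → unitInterval) → ℝ) : Prop :=
  Measurable F ∧ ∃ C, ∀ T, |F T| ≤ C

theorem IsBddMeasurable.integrable {F : (ℤ → unitInterval) → ℝ} (hF : IsBddMeasurable F) :
    Integrable F timesLaw := by
  obtain ⟨hm, C, hC⟩ := hF
  exact Integrable.of_bound hm.aestronglyMeasurable C (.of_forall hC)

theorem IsBddMeasurable.mul {F G : (ℤ → unitInterval) → ℝ} (hF : IsBddMeasurable F)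
    (hG : IsBddMeasurable G) : IsBddMeasurable fun T => F T * G T := by
  obtain ⟨hm, C, hC⟩ := hF
  obtain ⟨hm', C', hC'⟩ := hG
  refine ⟨hm.mul hm', C * C', fun T => ?_⟩
  rw [abs_mul]
  exact mul_le_mul (hC T) (hC' T) (abs_nonneg _) ((abs_nonneg _).trans (hC T))

theorem IsBddMeasurable.add {F G : (ℤ → unitInterval) → ℝ} (hF : IsBddMeasurable F)
    (hG : IsBddMeasurable G) : IsBddMeasurable fun T => F T + G T := by
  obtain ⟨hm, C, hC⟩ := hF
  obtain ⟨hm', C', hC'⟩ := hG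
  exact ⟨hm.add hm', C + C', fun T => (abs_add_le _ _).trans (add_le_add (hC T) (hC' T))⟩

theorem isBddMeasurable_const (c : ℝ) : IsBddMeasurable fun _ => c :=
  ⟨measurable_const, |c|, fun _ => le_rfl⟩

theorem isBddMeasurable_indicator {s : Set (ℤ → unitInterval)} [DecidablePred (· ∈ s)]
    (hs : MeasurableSet s) : IsBddMeasurable fun T => if T ∈ s then 1 else 0 :=
  ⟨Measurable.ite hs measurable_const measurable_const, 1,
    fun T => by dsimp only; split_ifs <;> simp⟩

theorem isBddMeasurable_lt (i j : ℤ) : IsBddMeasurable fun T => if T i < T j then 1 else 0 :=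
  isBddMeasurable_indicator (s := {T | T i < T j})
    (measurableSet_lt (measurable_pi_apply i) (measurable_pi_apply j))

theorem isBddMeasurable_le (i : ℤ) (t : unitInterval) :
    IsBddMeasurable fun T => if T i ≤ t then 1 else 0 :=
  isBddMeasurable_indicator (s := {T | T i ≤ t})
    (measurableSet_le (measurable_pi_apply i) measurable_const)

theorem isBddMeasurable_comp_eval {f : ℝ → ℝ} (hf : Continuous f) (i : ℤ) :
    IsBddMeasurable fun T => f (T i) := by
  have hc : Continuous fun x : unitInterval => f x := hf.comp continuous_subtype_val
  obtain ⟨C, hC⟩ := isCompact_univ.exists_bound_of_continuousOn hc.continuousOn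
  exact ⟨hc.measurable.comp (measurable_pi_apply i), C, fun T => hC _ (Set.mem_univ _)⟩

theorem isBddMeasurable_comp_eval₂ {f : ℝ → ℝ → ℝ} (hf : Continuous fun q : ℝ × ℝ => f q.1 q.2)
    (i j : ℤ) : IsBddMeasurable fun T => f (T i) (T j) := by
  have hc : Continuous fun x : unitInterval × unitInterval => f x.1 x.2 :=
    hf.comp ((continuous_subtype_val.comp continuous_fst).prodMk
      (continuous_subtype_val.comp continuous_snd))
  obtain ⟨C, hC⟩ := isCompact_univ.exists_bound_of_continuousOn hc.continuousOn
  have hm : Measurable fun T : ℤ → unitInterval => (T i, T j) :=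
    (measurable_pi_apply i).prodMk (measurable_pi_apply j)
  exact ⟨hc.measurable.comp hm, C,
    fun T => hC (T i, T j) (Set.mem_univ _)⟩

theorem measurable_altRun (n : ℕ) : Measurable (altRun n) := by
  induction n with
  | zero => exact measurable_const
  | succ n ih =>
    refine measurable_const.sub (Measurable.ite ?_ ?_ measurable_const)
    · exact measurableSet_lt (measurable_pi_apply 1) (measurable_pi_apply 0)
    · exact ih.comp (measurable_pi_lambda _ fun k => measurable_pi_apply (k + 1))

theorem isBddMeasurable_altRun (n : ℕ) (σ : ℕ → ℤ) :
    IsBddMeasurable fun T => altRun n fun k => T (σ k) :=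
  ⟨(measurable_altRun n).comp (measurable_pi_lambda _ fun k => measurable_pi_apply (σ k)), 1,
    fun _ => abs_altRun_le_one _ _⟩

theorem integral_update {F : (ℤ → unitInterval) → ℝ} (hF : IsBddMeasurable F) (s : ℤ) :
    ∫ T, F T ∂timesLaw = ∫ T, (∫ x, F (Function.update T s x)) ∂timesLaw := by
  have h := measurePreserving_update s
  rw [← integral_prod (fun q : (ℤ → unitInterval) × unitInterval => F (Function.update q.1 s q.2))
    (h.integrable_comp_of_integrable hF.integrable)]
  conv_lhs => rw [← h.map_eq]
  refine integral_map h.measurable.aemeasurable ?_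
  rw [h.map_eq]
  exact hF.integrable.aestronglyMeasurable

theorem integral_coe_unitInterval (f : ℝ → ℝ) :
    ∫ x : unitInterval, f x = ∫ x in (0 : ℝ)..1, f x := by
  rw [intervalIntegral.integral_of_le zero_le_one, ← integral_Icc_eq_integral_Ioc]
  exact integral_subtype_comap measurableSet_Icc f

theorem integral_ite_le_unitInterval (f : ℝ → ℝ) (u : unitInterval) :
    ∫ x : unitInterval, (if x ≤ u then f x else 0) = ∫ x in (0 : ℝ)..u, f x := by
  have h := integral_coe_unitInterval ((Set.Iic (u : ℝ)).indicator f)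
  rw [intervalIntegral.integral_of_le zero_le_one, setIntegral_indicator measurableSet_Iic] at h
  rw [intervalIntegral.integral_of_le u.2.1]
  convert h using 3
  · simp [Set.indicator, ← Subtype.coe_le_coe]
  · ext x
    simp only [Set.mem_Ioc, Set.mem_inter_iff, Set.mem_Iic]
    have := u.2.2
    exact ⟨fun h => ⟨⟨h.1, h.2.trans this⟩, h.2⟩, fun h => ⟨h.1.1, h.2⟩⟩

theorem integral_ite_lt_unitInterval (f : ℝ → ℝ) (u : unitInterval) :
    ∫ x : unitInterval, (if x < u then f x else 0) = ∫ x in (0 : ℝ)..u, f x := by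
  rw [← integral_ite_le_unitInterval]
  refine integral_congr_ae ?_
  have : ∀ᵐ x : unitInterval, x ≠ u := by simp [ae_iff]
  filter_upwards [this] with x hx
  simp only [lt_iff_le_and_ne, hx, ne_eq, not_false_eq_true, and_true]

/-- Integrating out an arrival time on which `H` does not depend. -/
theorem integral_mul_ite_lt {H : (ℤ → unitInterval) → ℝ} {i j k : ℤ} (hi : i ≠ j) (hk : k ≠ j)
    (hHj : ∀ T x, H (Function.update T j x) = H T) {f : ℝ → ℝ → ℝ}
    (hf : IsBddMeasurable fun T => H T * ((if T j < T i then 1 else 0) * f (T j) (T k))) :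
    ∫ T, H T * ((if T j < T i then 1 else 0) * f (T j) (T k)) ∂timesLaw =
      ∫ T, H T * (∫ x in (0 : ℝ)..T i, f x (T k)) ∂timesLaw := by
  rw [integral_update hf j]
  refine integral_congr_ae (.of_forall fun T => ?_)
  simp only [hHj, Function.update_self, Function.update_of_ne hi, Function.update_of_ne hk]
  rw [integral_const_mul, ← integral_ite_lt_unitInterval]
  simp only [ite_mul, one_mul, zero_mul]


/-! ### Truncated exponentials and the segment kernels -/

/-- The partial sums of the series of `exp (-x)`. -/
noncomputable def expNegSum (n : ℕ) (x : ℝ) : ℝ :=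
  ∑ k ∈ Finset.range n, (-x) ^ k / (k.factorial : ℝ)

theorem expNegSum_succ (n : ℕ) (x : ℝ) :
    expNegSum (n + 1) x = expNegSum n x + (-x) ^ n / (n.factorial : ℝ) :=
  Finset.sum_range_succ _ n

theorem expNegSum_succ_zero (n : ℕ) : expNegSum (n + 1) 0 = 1 := by
  simp [expNegSum, Finset.sum_range_succ']

theorem continuous_expNegSum (n : ℕ) : Continuous (expNegSum n) := by
  unfold expNegSum
  fun_prop

theorem hasDerivAt_expNegSum_succ (n : ℕ) (x : ℝ) :
    HasDerivAt (expNegSum (n + 1)) (-expNegSum n x) x := by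
  induction n with
  | zero =>
    have : expNegSum (0 + 1) = fun _ => 1 := by
      funext y
      simp [expNegSum]
    rw [this]
    simpa [expNegSum] using hasDerivAt_const x (1 : ℝ)
  | succ n ih =>
    have h := ih.add (((hasDerivAt_id x).neg.pow (n + 1)).div_const ((n + 1).factorial : ℝ))
    refine (h.congr_of_eventuallyEq (f₁ := expNegSum (n + 1 + 1))
      (.of_forall fun y => ?_)).congr_deriv ?_
    · rw [expNegSum_succ (n + 1)]
      rfl
    · rw [expNegSum_succ n, Nat.factorial_succ]
      have h1 : (n.factorial : ℝ) ≠ 0 := by positivity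
      have h2 : (n + 1 : ℝ) ≠ 0 := by positivity
      push_cast
      simp only [id, Pi.neg_apply]
      field_simp
      ring

/-- This is the recursion of `altRun` after averaging over the next arrival time, which must lie
below `u` for the run to continue. -/
theorem one_sub_integral_expNegSum (n : ℕ) (u : ℝ) :
    1 - ∫ x in (0 : ℝ)..u, expNegSum (n + 1) x = expNegSum (n + 2) u := by
  have h := intervalIntegral.integral_eq_sub_of_hasDerivAt
    (f := fun x => -expNegSum (n + 2) x) (f' := expNegSum (n + 1)) (a := 0) (b := u)
    (fun x _ => by simpa using (hasDerivAt_expNegSum_succ (n + 1) x).fun_neg)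
    ((continuous_expNegSum _).intervalIntegrable _ _)
  rw [h, expNegSum_succ_zero]
  ring

theorem abs_expNegSum_le (n : ℕ) {x : ℝ} (hx : x ∈ Set.Icc (0 : ℝ) 1) :
    |expNegSum n x| ≤ Real.exp 1 := by
  refine (Finset.abs_sum_le_sum_abs _ _).trans ?_
  refine le_trans (Finset.sum_le_sum fun k _ => ?_) (Real.sum_le_exp_of_nonneg zero_le_one n)
  rw [abs_div, abs_pow, abs_neg, abs_of_nonneg hx.1, Nat.abs_cast]
  gcongr
  exacts [hx.1, hx.2]

theorem tendsto_expNegSum (x : ℝ) :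
    Filter.Tendsto (fun n => expNegSum n x) Filter.atTop (nhds (Real.exp (-x))) := by
  have h := (NormedSpace.expSeries_div_hasSum_exp (-x)).tendsto_sum_nat
  rwa [← Real.exp_eq_exp_ℝ] at h

/-- The conditional expectation of `altRun (n + 1)` on a segment, given that the arrival times at
its far and near ends are `u` and `v`. -/
noncomputable def segmentRun (n : ℕ) (u v : ℝ) : ℝ :=
  expNegSum (n + 1) v + (-1) ^ (n + 1) * ((if u < v then 1 else 0) *
    ((v - u) ^ n / (n.factorial : ℝ)))

theorem integral_ite_mul_pow (n : ℕ) {u : ℝ} (hu : 0 ≤ u) {v : ℝ} (hv : 0 ≤ v) :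
    ∫ x in (0 : ℝ)..v, (if u < x then 1 else 0) * ((x - u) ^ n / (n.factorial : ℝ)) =
      (if u < v then 1 else 0) * ((v - u) ^ (n + 1) / ((n + 1).factorial : ℝ)) := by
  have h0 : (fun x => (if u < x then 1 else 0) * ((x - u) ^ n / (n.factorial : ℝ))) =
      (Set.Ioi u).indicator fun x => (x - u) ^ n / (n.factorial : ℝ) := by
    funext x
    simp [Set.indicator]
  have h1 : Set.Ioc 0 v ∩ Set.Ioi u = Set.Ioc u v := by
    ext x
    simp only [Set.mem_inter_iff, Set.mem_Ioc, Set.mem_Ioi]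
    exact ⟨fun h => ⟨h.2, h.1.2⟩, fun h => ⟨⟨hu.trans_lt h.1, h.2⟩, h.1⟩⟩
  rw [intervalIntegral.integral_of_le hv, h0, setIntegral_indicator measurableSet_Ioi, h1]
  split_ifs with h
  · rw [← intervalIntegral.integral_of_le h.le, intervalIntegral.integral_div,
      intervalIntegral.integral_comp_sub_right (fun x => x ^ n), integral_pow, Nat.factorial_succ]
    simp
    field_simp
  · simp [Set.Ioc_eq_empty h]

/-- The same recursion with the far end time held fixed. The extra term of `segmentRun` is the
signed probability `(v - u) ^ n / n!` that the `n` interior times descend all the way from `v` to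
`u`. -/
theorem one_sub_integral_segmentRun (n : ℕ) {u v : ℝ} (hu : 0 ≤ u) (hv : 0 ≤ v) :
    1 - ∫ x in (0 : ℝ)..v, segmentRun n u x = segmentRun (n + 1) u v := by
  have hI : IntervalIntegrable
      (fun x => (if u < x then 1 else 0) * ((x - u) ^ n / (n.factorial : ℝ))) volume 0 v := by
    have h0 : (fun x => (if u < x then 1 else 0) * ((x - u) ^ n / (n.factorial : ℝ))) =
        (Set.Ioi u).indicator fun x => (x - u) ^ n / (n.factorial : ℝ) := by
      funext x
      simp [Set.indicator]
    have h1 : IntervalIntegrable (fun x : ℝ => (x - u) ^ n / (n.factorial : ℝ)) volume 0 v :=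
      Continuous.intervalIntegrable (by fun_prop) _ _
    rw [h0]
    exact ⟨h1.1.indicator measurableSet_Ioi, h1.2.indicator measurableSet_Ioi⟩
  unfold segmentRun
  rw [intervalIntegral.integral_add ((continuous_expNegSum _).intervalIntegrable _ _)
    (hI.const_mul _), intervalIntegral.integral_const_mul, integral_ite_mul_pow n hu hv,
    ← one_sub_integral_expNegSum]
  ring

theorem integral_abs_pow (n : ℕ) (a b : ℝ) :
    ∫ x in a..b, |x| ^ n = (b * |b| ^ n - a * |a| ^ n) / (n + 1) := by
  -- Excluding 0 leaves two half-lines on which `|x|` is linear, and continuity covers the excluded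
  -- point.
  rw [MeasureTheory.integral_eq_of_hasDerivAt_off_countable (fun x => x * |x| ^ n / (n + 1)) _
    (Set.countable_singleton 0)]
  · ring
  · exact Continuous.continuousOn (by fun_prop)
  · rintro x ⟨-, hx⟩
    have hn : (n + 1 : ℝ) ≠ 0 := by positivity
    rcases lt_or_gt_of_ne (show x ≠ 0 from hx) with h | h
    · have h1 := (((hasDerivAt_id x).neg.pow (n + 1)).neg.div_const (n + 1 : ℝ))
      refine (h1.congr_of_eventuallyEq ?_).congr_deriv ?_
      · filter_upwards [eventually_lt_nhds h] with y hy
        simp [abs_of_neg hy, pow_succ]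
        ring
      · simp [abs_of_neg h]
        field_simp
    · have h1 := (((hasDerivAt_id x).pow (n + 1)).div_const (n + 1 : ℝ))
      refine (h1.congr_of_eventuallyEq ?_).congr_deriv ?_
      · filter_upwards [eventually_gt_nhds h] with y hy
        simp [abs_of_pos hy, pow_succ]
        ring
      · simp [abs_of_pos h]
        field_simp
  · exact Continuous.intervalIntegrable (by fun_prop) _ _

/-- The conditional probability that both ends of an isolated segment of length `n + 1` get
occupied, given their arrival times `u` and `v`. -/
noncomputable def segmentPair (n : ℕ) (u v : ℝ) : ℝ :=
  expNegSum (n + 1) (u + v) +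
    (-1) ^ (n + 1) * (((u + v) ^ n + |u - v| ^ n) / (2 * (n.factorial : ℝ)))

theorem segmentPair_comm (n : ℕ) (u v : ℝ) : segmentPair n u v = segmentPair n v u := by
  rw [segmentPair, segmentPair, add_comm v u, abs_sub_comm v u]

theorem continuous_segmentPair (n : ℕ) : Continuous fun q : ℝ × ℝ => segmentPair n q.1 q.2 := by
  unfold segmentPair
  exact ((continuous_expNegSum _).comp (continuous_fst.add continuous_snd)).add (by fun_prop)

/-- The recursion behind `integral_mul_segment`: the end with time `u` is blocked exactly through an
earlier neighbour, whose time `x` is integrated over `[0, u]`. -/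
theorem segmentRun_sub_integral_segmentPair (n : ℕ) {u v : ℝ} (hv : 0 ≤ v) :
    segmentRun (n + 1) u v - ∫ x in (0 : ℝ)..u, segmentPair n x v = segmentPair (n + 1) u v := by
  have h1 : ∫ x in (0 : ℝ)..u, expNegSum (n + 1) (x + v) =
      expNegSum (n + 2) v - expNegSum (n + 2) (u + v) := by
    rw [intervalIntegral.integral_comp_add_right (expNegSum (n + 1)), zero_add,
      ← intervalIntegral.integral_interval_sub_left (a := 0)
        ((continuous_expNegSum _).intervalIntegrable _ _)
        ((continuous_expNegSum _).intervalIntegrable _ _),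
      ← one_sub_integral_expNegSum, ← one_sub_integral_expNegSum]
    ring
  have h2 : ∫ x in (0 : ℝ)..u, (x + v) ^ n = ((u + v) ^ (n + 1) - v ^ (n + 1)) / (n + 1) := by
    rw [intervalIntegral.integral_comp_add_right (fun x => x ^ n), integral_pow, zero_add]
  have h3 : ∫ x in (0 : ℝ)..u, |x - v| ^ n =
      ((u - v) * |u - v| ^ n + v ^ (n + 1)) / (n + 1) := by
    rw [intervalIntegral.integral_comp_sub_right (fun x => |x| ^ n), integral_abs_pow, zero_sub,
      abs_neg, abs_of_nonneg hv, pow_succ]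
    ring
  have hc : Continuous fun x => expNegSum (n + 1) (x + v) :=
    (continuous_expNegSum _).comp (by fun_prop)
  unfold segmentPair segmentRun
  rw [intervalIntegral.integral_add (hc.intervalIntegrable _ _)
    (Continuous.intervalIntegrable (by fun_prop) _ _), intervalIntegral.integral_const_mul,
    intervalIntegral.integral_div, intervalIntegral.integral_add
    (Continuous.intervalIntegrable (by fun_prop) _ _)
    (Continuous.intervalIntegrable (by fun_prop) _ _), h1, h2, h3, Nat.factorial_succ]
  have hf : (n.factorial : ℝ) ≠ 0 := by positivity
  have hn : (n + 1 : ℝ) ≠ 0 := by positivity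
  push_cast
  split_ifs with h
  · rw [abs_of_neg (sub_neg.2 h), show v - u = -(u - v) by ring]
    field_simp
    ring
  · rw [abs_of_nonneg (sub_nonneg.2 (not_lt.1 h))]
    field_simp
    ring

theorem integral_exp_neg_mul_segmentPair (n : ℕ) {u : ℝ} (hu : 0 ≤ u) :
    ∫ v in (0 : ℝ)..u, Real.exp (-v) * segmentPair n u v =
      1 / 2 * Real.exp (-u) * (1 - expNegSum (n + 1) (2 * u)) := by
  have hexp : ∀ v : ℝ, HasDerivAt (fun v => Real.exp (-v)) (-Real.exp (-v)) v := fun v => by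
    simpa using (hasDerivAt_id v).neg.exp
  -- For `v ≤ u` the absolute value opens, and the powers `(u ± v) ^ n / n!` turn `expNegSum (n +
  -- 1)` into `expNegSum n`; this makes the antiderivative explicit.
  have hd : ∀ v ∈ Set.uIcc 0 u, HasDerivAt
      (fun v => 1 / 2 * (Real.exp (-v) * (expNegSum (n + 1) (u - v) - expNegSum (n + 1) (u + v))))
      (Real.exp (-v) * segmentPair n u v) v := by
    intro v hv
    rw [Set.uIcc_of_le hu] at hv
    have h1 := (hasDerivAt_expNegSum_succ n (u - v)).comp v ((hasDerivAt_id v).const_sub u)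
    have h2 := (hasDerivAt_expNegSum_succ n (u + v)).comp v ((hasDerivAt_id v).const_add u)
    refine (((hexp v).mul (h1.sub h2)).const_mul (1 / 2)).congr_deriv ?_
    rw [segmentPair, abs_of_nonneg (sub_nonneg.2 hv.2)]
    simp only [Function.comp_apply, Pi.sub_apply]
    rw [expNegSum_succ n, expNegSum_succ n, neg_pow (u + v), neg_pow (u - v)]
    field_simp
    ring
  have hc : Continuous fun v => Real.exp (-v) * segmentPair n u v :=
    (Real.continuous_exp.comp continuous_neg).mul
      ((continuous_segmentPair n).comp (by fun_prop : Continuous fun v : ℝ => (u, v)))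
  rw [intervalIntegral.integral_eq_sub_of_hasDerivAt hd (hc.intervalIntegrable _ _), sub_self,
    expNegSum_succ_zero, sub_zero, add_zero, sub_self, two_mul u]
  ring

/-! ### The pair probability and the parity series -/

theorem hasDerivAt_exp_neg_two_mul (u : ℝ) :
    HasDerivAt (fun u : ℝ => Real.exp (-2 * u)) (-2 * Real.exp (-2 * u)) u := by
  simpa [mul_comm] using ((hasDerivAt_id u).const_mul (-2)).exp

/-- The probability that two sites at distance `s` are both occupied at time `t`. -/
noncomputable def pairProb (s : ℕ) (t : ℝ) : ℝ :=
  ∫ u in (0 : ℝ)..t, Real.exp (-2 * u) * (1 - expNegSum s (2 * u))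

theorem pairProb_zero (t : ℝ) : pairProb 0 t = (1 - Real.exp (-2 * t)) / 2 := by
  rw [pairProb, intervalIntegral.integral_eq_sub_of_hasDerivAt
    (f := fun u => -(1 / 2) * Real.exp (-2 * u))]
  · simp
    ring
  · intro u _
    refine ((hasDerivAt_exp_neg_two_mul u).const_mul _).congr_deriv ?_
    simp [expNegSum]
  · exact Continuous.intervalIntegrable (by simp [expNegSum]; fun_prop) _ _

/-- The derivative of `expNegSum (s + 1)` is `-expNegSum s`, so the sum of the two integrands is an
exact derivative although neither is treated separately. -/
theorem pairProb_add_succ (s : ℕ) (t : ℝ) :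
    pairProb s t + pairProb (s + 1) t =
      1 / 2 - Real.exp (-2 * t) + 1 / 2 * Real.exp (-2 * t) * expNegSum (s + 1) (2 * t) := by
  have hc : ∀ s, Continuous fun u : ℝ => Real.exp (-2 * u) * (1 - expNegSum s (2 * u)) :=
    fun s => Continuous.mul (by fun_prop)
      (continuous_const.sub ((continuous_expNegSum s).comp (by fun_prop)))
  rw [pairProb, pairProb, ← intervalIntegral.integral_add ((hc _).intervalIntegrable _ _)
    ((hc _).intervalIntegrable _ _), intervalIntegral.integral_eq_sub_of_hasDerivAt
    (f := fun u => Real.exp (-2 * u) * (1 / 2 * expNegSum (s + 1) (2 * u) - 1))]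
  · simp [expNegSum_succ_zero]
    ring
  · intro u _
    have h := (hasDerivAt_expNegSum_succ s (2 * u)).comp u ((hasDerivAt_id u).const_mul 2)
    refine ((hasDerivAt_exp_neg_two_mul u).mul ((h.const_mul (1 / 2)).sub_const 1)).congr_deriv ?_
    simp only [Function.comp_apply]
    ring
  · exact ((hc _).add (hc _)).intervalIntegrable _ _

theorem summable_parity_exp (s : ℕ) (x : ℝ) :
    Summable fun n : ℕ => x ^ (2 * n + s + 1) / ((2 * n + s + 1).factorial : ℝ) :=
  (Real.summable_pow_div_factorial x).comp_injective
    (i := fun n => 2 * n + s + 1) fun a b h => by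
      have : 2 * a + s + 1 = 2 * b + s + 1 := h
      omega

/-- The two series are the even and odd terms of the exponential series from index `s + 1` on. -/
theorem tsum_parity_exp_add_succ (s : ℕ) (x : ℝ) :
    ∑' n : ℕ, x ^ (2 * n + s + 1) / ((2 * n + s + 1).factorial : ℝ) +
      ∑' n : ℕ, x ^ (2 * n + (s + 1) + 1) / ((2 * n + (s + 1) + 1).factorial : ℝ) =
      Real.exp x - expNegSum (s + 1) (-x) := by
  have h := tsum_even_add_odd (f := fun k : ℕ => x ^ (k + (s + 1)) / ((k + (s + 1)).factorial : ℝ))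
    (summable_parity_exp s x)
    ((summable_parity_exp (s + 1) x).congr fun n => by
      rw [show 2 * n + (s + 1) + 1 = 2 * n + 1 + (s + 1) by ring])
  have h' := (Real.summable_pow_div_factorial x).sum_add_tsum_nat_add (s + 1)
  have h'' := (NormedSpace.expSeries_div_hasSum_exp x).tsum_eq
  rw [← Real.exp_eq_exp_ℝ] at h''
  rw [expNegSum, neg_neg, ← h'', ← h', add_sub_cancel_left, ← h]
  congr 1
  refine tsum_congr fun n => ?_
  rw [show 2 * n + (s + 1) + 1 = 2 * n + 1 + (s + 1) by ring]

theorem pairProb_sub_sq (s : ℕ) (t : ℝ) :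
    pairProb s t - pairProb 0 t * pairProb 0 t = -(1 / 2) * Real.exp (-2 * t) *
      ∑' n : ℕ, (-2 * t) ^ (2 * n + s + 1) / ((2 * n + s + 1).factorial : ℝ) := by
  induction s with
  | zero =>
    have h := (Real.hasSum_sinh (-2 * t)).tsum_eq
    simp only [add_zero]
    rw [h, Real.sinh_eq, pairProb_zero, Real.exp_neg]
    field_simp
    ring
  | succ s ih =>
    have h1 := pairProb_add_succ s t
    have h2 := tsum_parity_exp_add_succ s (-2 * t)
    rw [show -(-2 * t) = 2 * t by ring] at h2
    rw [← eq_sub_iff_add_eq'] at h1 h2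
    rw [h1, h2, mul_sub, ← ih, pairProb_zero]
    ring


/-! ### Conditional expectations of runs -/

theorem altRun_update {n : ℕ} {σ : ℕ → ℤ} {j : ℤ} (hj : ∀ k, σ k ≠ j) (T : ℤ → unitInterval)
    (x : unitInterval) :
    altRun n (fun k => Function.update T j x (σ k)) = altRun n fun k => T (σ k) := by
  simp only [Function.update_of_ne (hj _)]

theorem integral_mul_one_sub_ite {H G : (ℤ → unitInterval) → ℝ} (hH : IsBddMeasurable H)
    (hG : IsBddMeasurable G) (i j : ℤ) :
    ∫ T, H T * (1 - if T j < T i then G T else 0) ∂timesLaw =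
      ∫ T, H T ∂timesLaw - ∫ T, H T * (if T j < T i then 1 else 0) * G T ∂timesLaw := by
  rw [← integral_sub hH.integrable ((hH.mul (isBddMeasurable_lt j i)).mul hG).integrable]
  refine integral_congr_ae (.of_forall fun T => ?_)
  dsimp only
  split_ifs <;> ring

/-- The weight `H`, free of the later times on the path, makes this a conditional expectation given
`T (σ 0)` and all times off the path. In the induction the indicator of the first descent is
absorbed into `H`. -/
theorem integral_mul_altRun (n : ℕ) {σ : ℕ → ℤ} (hσ : Function.Injective σ)
    {H : (ℤ → unitInterval) → ℝ} (hH : IsBddMeasurable H)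
    (hHσ : ∀ k T x, H (Function.update T (σ (k + 1)) x) = H T) :
    ∫ T, H T * altRun n (fun k => T (σ k)) ∂timesLaw =
      ∫ T, H T * expNegSum (n + 1) (T (σ 0)) ∂timesLaw := by
  induction n generalizing σ H with
  | zero => simp [altRun_zero, expNegSum]
  | succ n ih =>
    have hne : ∀ {k l : ℕ}, k ≠ l → σ k ≠ σ l := fun h => hσ.ne h
    have h1 := ih (σ := fun k => σ (k + 1)) (fun a b h => by simpa using hσ h)
      (H := fun T => H T * if T (σ 1) < T (σ 0) then 1 else 0) (hH.mul (isBddMeasurable_lt _ _))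
      (fun k T x => by
        rw [hHσ, Function.update_of_ne (hne (by omega)), Function.update_of_ne (hne (by omega))])
    have he := isBddMeasurable_comp_eval (continuous_expNegSum (n + 1)) (σ 1)
    have he' := isBddMeasurable_comp_eval (continuous_expNegSum (n + 2)) (σ 0)
    have h2 := integral_mul_ite_lt (hne (by omega : 0 ≠ 1)) (hne (by omega : 0 ≠ 1)) (hHσ 0)
      (f := fun x _ => expNegSum (n + 1) x) (hH.mul ((isBddMeasurable_lt _ _).mul he))
    simp only [← mul_assoc] at h2
    simp only [altRun_succ n]
    rw [integral_mul_one_sub_ite hH (isBddMeasurable_altRun n fun k => σ (k + 1)), h1, h2,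
      ← integral_sub hH.integrable]
    · refine integral_congr_ae (.of_forall fun T => ?_)
      dsimp only
      rw [← one_sub_integral_expNegSum]
      ring
    · refine (hH.mul ((isBddMeasurable_const 1).add
        ((isBddMeasurable_const (-1)).mul he'))).integrable.congr (.of_forall fun T => ?_)
      dsimp only
      rw [← one_sub_integral_expNegSum]
      ring

theorem isBddMeasurable_segmentRun (n : ℕ) (i j : ℤ) :
    IsBddMeasurable fun T => segmentRun n (T i) (T j) := by
  unfold segmentRun
  refine (isBddMeasurable_comp_eval (continuous_expNegSum (n + 1)) j).add
    ((isBddMeasurable_const _).mul ((isBddMeasurable_lt i j).mul ?_))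
  exact isBddMeasurable_comp_eval₂ (f := fun u v => (v - u) ^ n / (n.factorial : ℝ))
    (by fun_prop) i j

/-- Only the interior times are averaged: `H` may depend on both ends `σ 0` and `σ (n + 1)`. -/
theorem integral_mul_altRun_segment (n : ℕ) {σ : ℕ → ℤ} (hσ : Function.Injective σ)
    {H : (ℤ → unitInterval) → ℝ} (hH : IsBddMeasurable H)
    (hHσ : ∀ k < n, ∀ T x, H (Function.update T (σ (k + 1)) x) = H T) :
    ∫ T, H T * altRun (n + 1) (fun k => T (σ k)) ∂timesLaw =
      ∫ T, H T * segmentRun n (T (σ (n + 1))) (T (σ 0)) ∂timesLaw := by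
  induction n generalizing σ H with
  | zero =>
    refine integral_congr_ae (.of_forall fun T => ?_)
    simp only [altRun_zero, altRun_succ, segmentRun, expNegSum, zero_add, Subtype.coe_lt_coe]
    split_ifs <;> simp
  | succ n ih =>
    have hne : ∀ {k l : ℕ}, k ≠ l → σ k ≠ σ l := fun h => hσ.ne h
    have h1 := ih (σ := fun k => σ (k + 1)) (fun a b h => by simpa using hσ h)
      (H := fun T => H T * if T (σ 1) < T (σ 0) then 1 else 0) (hH.mul (isBddMeasurable_lt _ _))
      (fun k hk T x => by
        rw [hHσ _ (by omega), Function.update_of_ne (hne (by omega)),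
          Function.update_of_ne (hne (by omega))])
    have he := isBddMeasurable_segmentRun n (σ (n + 2)) (σ 1)
    have he' := isBddMeasurable_segmentRun (n + 1) (σ (n + 2)) (σ 0)
    have h2 := integral_mul_ite_lt (hne (by omega : 0 ≠ 1)) (hne (by omega : n + 2 ≠ 1))
      (hHσ 0 (by omega)) (f := fun x y => segmentRun n y x)
      (hH.mul ((isBddMeasurable_lt _ _).mul he))
    simp only [← mul_assoc] at h2
    have hs : ∀ T : ℤ → unitInterval, segmentRun (n + 1) (T (σ (n + 2))) (T (σ 0)) =
        1 - ∫ x in (0 : ℝ)..T (σ 0), segmentRun n (T (σ (n + 2))) x :=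
      fun T => (one_sub_integral_segmentRun n (T _).2.1 (T _).2.1).symm
    simp only [altRun_succ (n + 1)]
    rw [integral_mul_one_sub_ite hH (isBddMeasurable_altRun (n + 1) fun k => σ (k + 1)), h1, h2,
      ← integral_sub hH.integrable]
    · refine integral_congr_ae (.of_forall fun T => ?_)
      dsimp only
      rw [hs]
      ring
    · refine (hH.mul ((isBddMeasurable_const 1).add
        ((isBddMeasurable_const (-1)).mul he'))).integrable.congr (.of_forall fun T => ?_)
      dsimp only
      rw [hs]
      ring

/-! ### Almost sure genericity -/

theorem ae_ne {i j : ℤ} (h : i ≠ j) : ∀ᵐ T ∂timesLaw, T i ≠ T j := by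
  have hm : MeasurableSet {T : ℤ → unitInterval | T i = T j} :=
    measurableSet_eq_fun (measurable_pi_apply i) (measurable_pi_apply j)
  have hp := (measurePreserving_update i).measure_preimage hm.nullMeasurableSet
  rw [ae_iff]
  simp only [ne_eq, not_not]
  rw [← hp, Measure.measure_prod_null ((measurePreserving_update i).measurable hm)]
  refine .of_forall fun T => ?_
  have : Prod.mk T ⁻¹' ((fun q : (ℤ → unitInterval) × unitInterval =>
      Function.update q.1 i q.2) ⁻¹' {T | T i = T j}) = {T j} := by
    ext x
    simp [Function.update_of_ne h.symm]
  dsimp only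
  rw [this]
  simp

theorem ray_injective {ε : ℤ} (hε : ε ≠ 0) (s : ℤ) :
    Function.Injective fun k : ℕ => s + ε * k := fun a b h => by
  simpa [hε] using h

theorem ae_exists_not_lt {ε : ℤ} (hε : ε ≠ 0) (s : ℤ) :
    ∀ᵐ T ∂timesLaw, ∃ k, ¬ ray ε s T (k + 1) < ray ε s T k := by
  have hmeas : ∀ n, MeasurableSet {T | ∀ k ≤ n, ray ε s T (k + 1) < ray ε s T k} := by
    intro n
    simp only [Set.ofPred_forall]
    exact MeasurableSet.iInter fun k => MeasurableSet.iInter fun _ =>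
      measurableSet_lt (measurable_pi_apply _) (measurable_pi_apply _)
  have hbound : ∀ n : ℕ, timesLaw.real {T | ∀ k, ray ε s T (k + 1) < ray ε s T k} ≤
      1 / ((n + 1).factorial : ℝ) := by
    intro n
    have hA : ∀ m, ∫ T, altRun m (ray ε s T) ∂timesLaw =
        ∫ T, expNegSum (m + 1) (T s) ∂timesLaw := fun m => by
      have hr : ∀ T, ray ε s T = fun k : ℕ => T (s + ε * k) := fun _ => rfl
      simpa [hr] using integral_mul_altRun m (ray_injective hε s) (isBddMeasurable_const 1)
        (fun _ _ _ => rfl)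
    have hi : ∀ m, Integrable (fun T => altRun m (ray ε s T)) timesLaw := fun m =>
      (isBddMeasurable_altRun m fun k => s + ε * k).integrable
    have he : ∀ m, Integrable (fun T : ℤ → unitInterval => expNegSum m (T s)) timesLaw := fun m =>
      (isBddMeasurable_comp_eval (continuous_expNegSum m) s).integrable
    calc timesLaw.real {T | ∀ k, ray ε s T (k + 1) < ray ε s T k}
        ≤ timesLaw.real {T | ∀ k ≤ n, ray ε s T (k + 1) < ray ε s T k} :=
          measureReal_mono fun T hT k _ => hT k
      -- The indicator of `n + 1` successive descents is a signed difference of two consecutive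
      -- `altRun`s. Their means are consecutive partial sums, so one term of the exponential series
      -- remains.
      _ = ∫ T, (-1) ^ n * (altRun n (ray ε s T) - altRun (n + 1) (ray ε s T)) ∂timesLaw := by
          rw [← integral_indicator_one (hmeas n)]
          refine integral_congr_ae (.of_forall fun T => ?_)
          simp only [altRun_sub_succ]
          rw [← mul_assoc, ← mul_pow, neg_one_mul, neg_neg, one_pow, one_mul]
          simp [Set.indicator]
      _ = ∫ T, (T s : ℝ) ^ (n + 1) / ((n + 1).factorial : ℝ) ∂timesLaw := by
          rw [integral_const_mul, integral_sub (hi _) (hi _), hA, hA,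
            ← integral_sub (he _) (he _), ← integral_const_mul]
          refine integral_congr_ae (.of_forall fun T => ?_)
          dsimp only
          rw [expNegSum_succ (n + 1), sub_add_cancel_left, neg_pow (T s : ℝ), pow_succ (-1 : ℝ)]
          have : ((-1 : ℝ) ^ n) * (-1) ^ n = 1 := by rw [← mul_pow]; simp
          linear_combination ((T s : ℝ) ^ (n + 1) / ((n + 1).factorial : ℝ)) * this
      _ ≤ ∫ T, 1 / ((n + 1).factorial : ℝ) ∂timesLaw := by
          refine integral_mono ?_ (integrable_const _) fun T => ?_
          · exact (isBddMeasurable_comp_eval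
              (f := fun x => x ^ (n + 1) / ((n + 1).factorial : ℝ)) (by fun_prop) s).integrable
          · dsimp only
            gcongr
            exact pow_le_one₀ (T s).2.1 (T s).2.2
      _ = 1 / ((n + 1).factorial : ℝ) := by simp
  have hlim : Filter.Tendsto (fun n : ℕ => 1 / ((n + 1).factorial : ℝ)) Filter.atTop (nhds 0) := by
    have := (FloorSemiring.tendsto_pow_div_factorial_atTop (1 : ℝ)).comp
      (Filter.tendsto_add_atTop_nat 1)
    simpa [Function.comp_def] using this
  have h0 := le_antisymm (ge_of_tendsto' hlim hbound) measureReal_nonneg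
  rw [ae_iff]
  simp only [not_exists, not_not]
  rwa [measureReal_eq_zero_iff] at h0

theorem ae_generic : ∀ᵐ T ∂timesLaw, Generic T := by
  refine Filter.Eventually.and ?_ (Filter.Eventually.and ?_ ?_)
  · exact ae_all_iff.2 fun s => ae_ne (by omega)
  · exact ae_all_iff.2 fun s => ae_exists_not_lt one_ne_zero s
  · exact ae_all_iff.2 fun s => ae_exists_not_lt (by decide) s


/-! ### One- and two-site probabilities of the truncated system -/

theorem isBddMeasurable_ray (n : ℕ) (ε s : ℤ) : IsBddMeasurable fun T => altRun n (ray ε s T) :=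
  isBddMeasurable_altRun n fun k => s + ε * k

theorem isBddMeasurable_segmentPair (n : ℕ) (i j : ℤ) :
    IsBddMeasurable fun T => segmentPair n (T i) (T j) :=
  isBddMeasurable_comp_eval₂ (continuous_segmentPair n) i j

/-- Expanding the first step of the run from the left end leaves the run from the right end alone,
minus the same pair problem on the segment shortened by one site. -/
theorem integral_mul_segment (n : ℕ) (i : ℤ) {H : (ℤ → unitInterval) → ℝ}
    (hH : IsBddMeasurable H)
    (hHi : ∀ k < n, ∀ T x, H (Function.update T (i + (k + 1)) x) = H T) :
    ∫ T, H T * (altRun (n + 1) (ray 1 i T) * altRun (n + 1) (ray (-1) (i + (n + 1)) T)) ∂timesLaw =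
      ∫ T, H T * segmentPair n (T i) (T (i + (n + 1))) ∂timesLaw := by
  induction n generalizing i H with
  | zero =>
    refine integral_congr_ae ?_
    filter_upwards [ae_ne (show i ≠ i + 1 by omega)] with T hT
    simp only [altRun_ray_succ, altRun_zero, segmentPair, expNegSum, Nat.cast_zero, zero_add,
      add_neg_cancel_right]
    rcases lt_or_gt_of_ne hT with h | h
    · simp [h]
    · simp [h]
  | succ n ih =>
    set j : ℤ := i + ((n + 1 : ℕ) + 1) with hj
    have hj' : j = i + 1 + (n + 1) := by rw [hj]; push_cast; ring
    have h1 := ih (i + 1) (H := fun T => H T * if T (i + 1) < T i then 1 else 0)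
      (hH.mul (isBddMeasurable_lt _ _)) (fun k hk T x => by
        have := hHi (k + 1) (by omega) T x
        rw [show i + (((k + 1 : ℕ) : ℤ) + 1) = i + 1 + (k + 1) by push_cast; ring] at this
        rw [this, Function.update_of_ne (by omega), Function.update_of_ne (by omega)])
    rw [← hj'] at h1
    have h2 := integral_mul_altRun_segment (n + 1) (ray_injective (by decide : (-1 : ℤ) ≠ 0) j) hH
      (fun k hk T x => by
        have := hHi (n - k) (by omega) T x
        rw [Nat.cast_sub (by omega)] at this
        convert this using 3
        rw [hj]
        push_cast
        ring)
    have hend : j + -1 * ((n + 1 + 1 : ℕ) : ℤ) = i := by rw [hj]; push_cast; ring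
    rw [hend, Nat.cast_zero, mul_zero, add_zero] at h2
    have hs := isBddMeasurable_segmentPair n (i + 1) j
    have h3 := integral_mul_ite_lt (i := i) (j := i + 1) (k := j) (by omega) (by omega)
      (fun T x => by simpa using hHi 0 (by omega) T x) (f := segmentPair n)
      (hH.mul ((isBddMeasurable_lt _ _).mul hs))
    simp only [← mul_assoc] at h3
    have hsplit : ∀ T, H T * (altRun (n + 1 + 1) (ray 1 i T) * altRun (n + 1 + 1) (ray (-1) j T)) =
        H T * altRun (n + 1 + 1) (ray (-1) j T) - H T * (if T (i + 1) < T i then 1 else 0) *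
          (altRun (n + 1) (ray 1 (i + 1) T) * altRun (n + 1) (ray (-1) j T)) := by
      intro T
      rw [altRun_ray_succ (n + 1) 1]
      split_ifs with h
      -- As `T (i + 1) < T i`, the leftward run from `j` cannot step from `i + 1` to `i`, so it may
      -- be truncated at the shorter segment.
      · have hlt : ¬ ray (-1) j T (n + 1 + 1) < ray (-1) j T (n + 1) := by
          have hend' : j + -1 * ((n + 1 : ℕ) : ℤ) = i + 1 := by rw [hj]; push_cast; ring
          rw [ray, ray, hend, hend']
          exact not_lt.2 h.le
        rw [altRun_eq_of_not_lt hlt (by omega : n + 1 ≤ n + 1 + 1)]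
        ring
      · ring
    have hr : ∀ T : ℤ → unitInterval, segmentPair (n + 1) (T i) (T j) =
        segmentRun (n + 1) (T i) (T j) -
        ∫ x in (0 : ℝ)..T i, segmentPair n x (T j) :=
      fun T => (segmentRun_sub_integral_segmentPair n (T j).2.1).symm
    have hR := hH.mul (isBddMeasurable_segmentRun (n + 1) i j)
    have hP := hH.mul (isBddMeasurable_segmentPair (n + 1) i j)
    simp only [hsplit]
    rw [integral_sub (hH.mul (isBddMeasurable_ray _ _ _)).integrable
      ((hH.mul (isBddMeasurable_lt _ _)).mul
        ((isBddMeasurable_ray _ _ _).mul (isBddMeasurable_ray _ _ _))).integrable, h1, h3]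
    change (∫ T, H T * altRun (n + 1 + 1) (fun k : ℕ => T (j + -1 * k)) ∂timesLaw) - _ = _
    rw [h2, ← integral_sub hR.integrable]
    · refine integral_congr_ae (.of_forall fun T => ?_)
      dsimp only
      rw [hr]
      ring
    · refine (hR.integrable.sub hP.integrable).congr (.of_forall fun T => ?_)
      dsimp only [Pi.sub_apply]
      rw [hr]
      ring

theorem integral_mul_altRun_ray (n : ℕ) {ε : ℤ} (hε : ε ≠ 0) (s : ℤ)
    {H : (ℤ → unitInterval) → ℝ} (hH : IsBddMeasurable H)
    (hHs : ∀ (k : ℕ) T x, H (Function.update T (s + ε * (k + 1)) x) = H T) :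
    ∫ T, H T * altRun n (ray ε s T) ∂timesLaw =
      ∫ T, H T * expNegSum (n + 1) (T s) ∂timesLaw := by
  have h := integral_mul_altRun n (ray_injective hε s) hH
    (fun k T x => by simpa using hHs k T x)
  rwa [Nat.cast_zero, mul_zero, add_zero] at h

theorem altRun_ray_update {n : ℕ} {ε s j : ℤ} (hj : ∀ k : ℕ, s + ε * k ≠ j)
    (T : ℤ → unitInterval) (x : unitInterval) :
    altRun n (ray ε s (Function.update T j x)) = altRun n (ray ε s T) :=
  altRun_update hj T x

theorem integral_truncState (m n : ℕ) (i : ℤ) (t : unitInterval) :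
    ∫ T, truncState m n i t T ∂timesLaw =
      ∫ T, (if T i ≤ t then 1 else 0) *
        (expNegSum (m + 1) (T i) * expNegSum (n + 1) (T i)) ∂timesLaw := by
  have hle := isBddMeasurable_le i t
  have he := isBddMeasurable_comp_eval (continuous_expNegSum (n + 1)) i
  have h1 := integral_mul_altRun_ray n one_ne_zero i (hle.mul (isBddMeasurable_ray m (-1) i))
    (fun k T x => by
      rw [altRun_ray_update (fun l => by omega), Function.update_of_ne (by omega)])
  have h2 := integral_mul_altRun_ray m (by decide : (-1 : ℤ) ≠ 0) i (hle.mul he)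
    (fun k T x => by
      rw [Function.update_of_ne (by omega)])
  unfold truncState
  rw [h1]
  refine Eq.trans (integral_congr_ae (.of_forall fun T => ?_)) (h2.trans
    (integral_congr_ae (.of_forall fun T => ?_)))
  · dsimp only
    ring
  · dsimp only
    ring

/-- The inward depth `n + 1 + m` reaches exactly `m` steps beyond the opposite site, matching the
outward depth there, as `altRun_add_mul` requires. The segment and the two outward runs are then
integrated one by one. -/
theorem integral_truncState_mul (m n : ℕ) (i : ℤ) (t : unitInterval) :
    ∫ T, truncState m (n + 1 + m) i t T * truncState (n + 1 + m) m (i + (n + 1)) t T ∂timesLaw =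
      ∫ T, (if T i ≤ t then 1 else 0) * (if T (i + (n + 1)) ≤ t then 1 else 0) *
        segmentPair n (T i) (T (i + (n + 1))) *
        (expNegSum (m + 1) (T i) * expNegSum (m + 1) (T (i + (n + 1)))) ∂timesLaw := by
  set j : ℤ := i + (n + 1) with hj
  have hle := (isBddMeasurable_le i t).mul (isBddMeasurable_le j t)
  have hs := isBddMeasurable_segmentPair n i j
  have hei := isBddMeasurable_comp_eval (continuous_expNegSum (m + 1)) i
  have hej := isBddMeasurable_comp_eval (continuous_expNegSum (m + 1)) j
  have hR := isBddMeasurable_ray m 1 j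
  have hL := isBddMeasurable_ray m (-1) i
  have h1 := integral_mul_segment n i (hle.mul (hL.mul hR)) (fun k hk T x => by
    rw [altRun_ray_update (fun l => by omega), altRun_ray_update (fun l => by omega),
      Function.update_of_ne (by omega), Function.update_of_ne (by omega)])
  rw [← hj] at h1
  have h2 := integral_mul_altRun_ray m one_ne_zero j ((hle.mul hs).mul hL)
    (fun k T x => by
      rw [altRun_ray_update (fun l => by omega),
        Function.update_of_ne (by omega), Function.update_of_ne (by omega)])
  have h3 := integral_mul_altRun_ray m (by decide : (-1 : ℤ) ≠ 0) i ((hle.mul hs).mul hej)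
    (fun k T x => by
      rw [Function.update_of_ne (by omega), Function.update_of_ne (by omega)])
  have hright : ∀ T, altRun (n + 1 + m) (ray 1 i T) * altRun m (ray 1 j T) =
      altRun (n + 1) (ray 1 i T) * altRun m (ray 1 j T) := fun T => by
    have hr : (fun k => ray 1 i T (k + (n + 1))) = ray 1 j T := by
      funext k
      simp only [ray]
      congr 1
      rw [hj]
      push_cast
      ring
    rw [← hr, altRun_add_mul]
  have hleft : ∀ T, altRun (n + 1 + m) (ray (-1) j T) * altRun m (ray (-1) i T) =
      altRun (n + 1) (ray (-1) j T) * altRun m (ray (-1) i T) := fun T => by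
    have hr : (fun k => ray (-1) j T (k + (n + 1))) = ray (-1) i T := by
      funext k
      simp only [ray]
      congr 1
      rw [hj]
      push_cast
      ring
    rw [← hr, altRun_add_mul]
  refine Eq.trans (integral_congr_ae (.of_forall fun T => ?_)) (h1.trans
    (Eq.trans (integral_congr_ae (.of_forall fun T => ?_)) (h2.trans
    (Eq.trans (integral_congr_ae (.of_forall fun T => ?_)) (h3.trans
    (integral_congr_ae (.of_forall fun T => ?_)))))))
  · dsimp only [truncState]
    linear_combination ((if T i ≤ t then 1 else 0) * (if T j ≤ t then 1 else 0)) *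
      (altRun (n + 1 + m) (ray (-1) j T) * altRun m (ray (-1) i T) * hright T +
        altRun (n + 1) (ray 1 i T) * altRun m (ray 1 j T) * hleft T)
  all_goals
    dsimp only
    ring

/-! ### Removing the truncation -/

theorem tendsto_integral_mul_expNegSum {H : (ℤ → unitInterval) → ℝ} (hH : IsBddMeasurable H)
    (i j : ℤ) :
    Tendsto (fun m => ∫ T, H T * (expNegSum (m + 1) (T i) * expNegSum (m + 1) (T j)) ∂timesLaw)
      atTop (𝓝 (∫ T, H T * (Real.exp (-T i) * Real.exp (-T j)) ∂timesLaw)) := by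
  obtain ⟨C, hC⟩ := hH.2
  refine tendsto_integral_of_dominated_convergence (fun _ => C * (Real.exp 1 * Real.exp 1))
    (fun m => ?_) (integrable_const _) (fun m => .of_forall fun T => ?_) (.of_forall fun T => ?_)
  · exact (hH.mul ((isBddMeasurable_comp_eval (continuous_expNegSum _) i).mul
      (isBddMeasurable_comp_eval (continuous_expNegSum _) j))).1.aestronglyMeasurable
  · rw [Real.norm_eq_abs, abs_mul, abs_mul]
    have h0 := (abs_nonneg _).trans (hC T)
    gcongr
    · exact hC T
    · exact abs_expNegSum_le _ (T i).2
    · exact abs_expNegSum_le _ (T j).2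
  · exact (((tendsto_expNegSum _).comp (tendsto_add_atTop_nat 1)).mul
      ((tendsto_expNegSum _).comp (tendsto_add_atTop_nat 1))).const_mul _

theorem isBddMeasurable_truncState (m n : ℕ) (s : ℤ) (t : unitInterval) :
    IsBddMeasurable (truncState m n s t) :=
  ((isBddMeasurable_le s t).mul (isBddMeasurable_ray m (-1) s)).mul (isBddMeasurable_ray n 1 s)

theorem abs_truncState_le_one (m n : ℕ) (s : ℤ) (t : unitInterval) (T : ℤ → unitInterval) :
    |truncState m n s t T| ≤ 1 := by
  rcases truncState_eq_zero_or_one m n s t T with h | h <;> simp [h]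

theorem ae_tendsto_truncState (s : ℤ) (t : unitInterval) {a b : ℕ → ℕ} (ha : Tendsto a atTop atTop)
    (hb : Tendsto b atTop atTop) :
    ∀ᵐ T ∂timesLaw, Tendsto (fun m => truncState (a m) (b m) s t T) atTop (𝓝 (state s t T)) := by
  filter_upwards [ae_generic] with T hT
  obtain ⟨k, hk⟩ := hT.exists_state_eq s
  refine tendsto_const_nhds.congr' ?_
  filter_upwards [ha.eventually_ge_atTop k, hb.eventually_ge_atTop k] with m h1 h2
  exact hk _ _ h1 h2 t

theorem aemeasurable_state (s : ℤ) (t : unitInterval) : AEMeasurable (state s t) timesLaw :=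
  aemeasurable_of_tendsto_metrizable_ae atTop
    (fun m => (isBddMeasurable_truncState m m s t).1.aemeasurable)
    (ae_tendsto_truncState s t tendsto_id tendsto_id)

theorem integral_ite_le_mul {g : ℝ → ℝ} (hg : Continuous g) (i : ℤ) (t : unitInterval) :
    ∫ T, (if T i ≤ t then 1 else 0) * g (T i) ∂timesLaw = ∫ x in (0 : ℝ)..t, g x := by
  rw [integral_update ((isBddMeasurable_le i t).mul (isBddMeasurable_comp_eval hg i)) i,
    ← integral_ite_le_unitInterval]
  simp

theorem integral_state (i : ℤ) (t : unitInterval) :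
    ∫ T, state i t T ∂timesLaw = pairProb 0 t := by
  have h1 : Tendsto (fun m => ∫ T, truncState m m i t T ∂timesLaw) atTop
      (𝓝 (∫ T, state i t T ∂timesLaw)) :=
    tendsto_integral_of_dominated_convergence (fun _ => 1)
      (fun m => (isBddMeasurable_truncState m m i t).1.aestronglyMeasurable) (integrable_const _)
      (fun m => .of_forall (abs_truncState_le_one m m i t))
      (ae_tendsto_truncState i t tendsto_id tendsto_id)
  simp only [integral_truncState] at h1
  rw [tendsto_nhds_unique h1 (tendsto_integral_mul_expNegSum (isBddMeasurable_le i t) i i),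
    integral_ite_le_mul (g := fun x => Real.exp (-x) * Real.exp (-x)) (by fun_prop), pairProb]
  congr 1
  funext u
  rw [← Real.exp_add, expNegSum, Finset.sum_range_zero, sub_zero, mul_one]
  congr 1
  ring

/-- The contribution of the event that `j` arrives before `i`; by symmetry it is half of the pair
probability. -/
theorem integral_pair_descending (n : ℕ) {i j : ℤ} (hij : i ≠ j) (t : unitInterval) :
    ∫ T, (if T i ≤ t then 1 else 0) * ((if T j < T i then 1 else 0) *
      (Real.exp (-T i) * (Real.exp (-T j) * segmentPair n (T i) (T j)))) ∂timesLaw =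
      1 / 2 * pairProb (n + 1) t := by
  have hc : Continuous fun q : ℝ × ℝ =>
      Real.exp (-q.2) * (Real.exp (-q.1) * segmentPair n q.2 q.1) := by
    have := (continuous_segmentPair n).comp continuous_swap
    exact Continuous.mul (by fun_prop) (Continuous.mul (by fun_prop) this)
  have hB : IsBddMeasurable fun T =>
      Real.exp (-T i) * (Real.exp (-T j) * segmentPair n (T i) (T j)) :=
    isBddMeasurable_comp_eval₂
      (f := fun x y => Real.exp (-y) * (Real.exp (-x) * segmentPair n y x)) hc j i
  have hg : Continuous fun u : ℝ => Real.exp (-u) *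
      (1 / 2 * Real.exp (-u) * (1 - expNegSum (n + 1) (2 * u))) :=
    Continuous.mul (by fun_prop) (Continuous.mul (by fun_prop)
      (continuous_const.sub ((continuous_expNegSum _).comp (by fun_prop))))
  rw [integral_mul_ite_lt (k := i) hij hij
    (f := fun x y => Real.exp (-y) * (Real.exp (-x) * segmentPair n y x))
    (fun T x => by rw [Function.update_of_ne hij])
    ((isBddMeasurable_le i t).mul ((isBddMeasurable_lt j i).mul hB))]
  simp only [intervalIntegral.integral_const_mul]
  simp_rw [fun T : ℤ → unitInterval => integral_exp_neg_mul_segmentPair n (T i).2.1]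
  rw [integral_ite_le_mul hg, pairProb, ← intervalIntegral.integral_const_mul]
  congr 1
  funext u
  rw [show -2 * u = -u + -u by ring, Real.exp_add]
  ring

theorem integral_state_mul (n : ℕ) (i : ℤ) (t : unitInterval) :
    ∫ T, state i t T * state (i + (n + 1)) t T ∂timesLaw = pairProb (n + 1) t := by
  set j : ℤ := i + (n + 1) with hj
  have hij : i ≠ j := by omega
  have hb : Tendsto (fun m => n + 1 + m) atTop atTop :=
    tendsto_atTop_mono (fun m => Nat.le_add_left m (n + 1)) tendsto_id
  have h1 : Tendsto (fun m => ∫ T, truncState m (n + 1 + m) i t T *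
      truncState (n + 1 + m) m j t T ∂timesLaw) atTop
      (𝓝 (∫ T, state i t T * state j t T ∂timesLaw)) := by
    refine tendsto_integral_of_dominated_convergence (fun _ => 1)
      (fun m => ((isBddMeasurable_truncState _ _ i t).mul
        (isBddMeasurable_truncState _ _ j t)).1.aestronglyMeasurable) (integrable_const _)
      (fun m => .of_forall fun T => ?_) ?_
    · rw [Real.norm_eq_abs, abs_mul]
      exact mul_le_one₀ (abs_truncState_le_one _ _ _ _ _) (abs_nonneg _)
        (abs_truncState_le_one _ _ _ _ _)
    · filter_upwards [ae_tendsto_truncState i t tendsto_id hb,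
        ae_tendsto_truncState j t hb tendsto_id] with T hi' hj'
      exact hi'.mul hj'
  simp only [hj, integral_truncState_mul] at h1
  simp only [← hj] at h1
  have hH := ((isBddMeasurable_le i t).mul (isBddMeasurable_le j t)).mul
    (isBddMeasurable_segmentPair n i j)
  rw [tendsto_nhds_unique h1 (tendsto_integral_mul_expNegSum hH i j)]
  have hexp : ∀ i, IsBddMeasurable fun T => Real.exp (-T i) := fun i =>
    isBddMeasurable_comp_eval (f := fun x => Real.exp (-x)) (by fun_prop) i
  have hB : ∀ i j, Integrable (fun T => (if T i ≤ t then 1 else 0) *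
      ((if T j < T i then 1 else 0) * (Real.exp (-T i) * (Real.exp (-T j) *
        segmentPair n (T i) (T j))))) timesLaw := fun i j =>
    ((isBddMeasurable_le i t).mul ((isBddMeasurable_lt j i).mul ((hexp i).mul
      ((hexp j).mul (isBddMeasurable_segmentPair n i j))))).integrable
  have hsum := congrArg₂ (· + ·) (integral_pair_descending n hij t)
    (integral_pair_descending n hij.symm t)
  rw [← integral_add (hB i j) (hB j i), ← add_mul, add_halves, one_mul] at hsum
  rw [← hsum]
  refine integral_congr_ae ?_
  filter_upwards [ae_ne hij] with T hT
  rw [segmentPair_comm n (T j) (T i)]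
  -- Just one of the two ordered terms survives, and the later arrival being at most `t` forces the
  -- earlier one to be.
  rcases lt_or_gt_of_ne hT with h | h
  · by_cases h' : T j ≤ t
    · simp [h, h', h.le.trans h', not_lt.2 h.le]
      ring
    · simp [h', not_lt.2 h.le]
  · by_cases h' : T i ≤ t
    · simp [h, h', h.le.trans h', not_lt.2 h.le]
      ring
    · simp [h', not_lt.2 h.le]

theorem integral_state_mul_self (i : ℤ) (t : unitInterval) :
    ∫ T, state i t T * state i t T ∂timesLaw = pairProb 0 t := by
  rw [← integral_state i t]
  refine integral_congr_ae ?_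
  filter_upwards [ae_generic] with T hT
  obtain ⟨k, hk⟩ := hT.exists_state_eq i
  rw [hk k k le_rfl le_rfl]
  rcases truncState_eq_zero_or_one k k i t T with h | h <;> simp [h]

theorem integral_state_zero_mul (s : ℤ) (t : unitInterval) :
    ∫ T, state 0 t T * state s t T ∂timesLaw = pairProb s.natAbs t := by
  obtain ⟨n, rfl | rfl⟩ := s.eq_nat_or_neg
  all_goals
    cases n with
    | zero => simpa using integral_state_mul_self 0 t
    | succ n => ?_
  · simpa [Int.natAbs_add_of_nonneg] using integral_state_mul n 0 t
  -- For negative `s` the base site is `s` itself, whose partner at distance `n + 1` is 0.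
  · have h := integral_state_mul n (-((n + 1 : ℕ) : ℤ)) t
    push_cast at h ⊢
    rw [neg_add_cancel] at h
    simp only [mul_comm (state 0 t _)]
    rw [h]
    congr 1

end RSA

theorem theorem2 :
    (∀ᵐ T ∂(RSA.timesLaw), ∃! η : ℤ → unitInterval → ℝ, RSA.IsEvolution T η) ∧
    (∀ (s : ℤ) (t : unitInterval), AEMeasurable (RSA.state s t) RSA.timesLaw) ∧
    ∀ (t : unitInterval) (s : ℤ),
      Summable (fun n : ℕ => (-2 * (t : ℝ)) ^ (2 * n + s.natAbs + 1) /
        ((2 * n + s.natAbs + 1).factorial : ℝ)) ∧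
      RSA.pairCorrelation s t =
        -(1 / 2) * Real.exp (-2 * (t : ℝ)) *
          ∑' n : ℕ, (-2 * (t : ℝ)) ^ (2 * n + s.natAbs + 1) /
            ((2 * n + s.natAbs + 1).factorial : ℝ) := by
  refine ⟨RSA.ae_generic.mono fun T hT => hT.existsUnique, RSA.aemeasurable_state,
    fun t s => ⟨RSA.summable_parity_exp _ _, ?_⟩⟩
  rw [RSA.pairCorrelation, RSA.covAt, RSA.integral_state_zero_mul, RSA.integral_state,
    RSA.integral_state, RSA.pairProb_sub_sq]
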